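/- Consider a Markov decision process with finite state space $\mathcal X$, finite action space $\mathcal A$, discount factor $\gamma\in[0,1)$, transition kernel $P(\cdot\mid x,a)$ and reward distributions $\mathcal R(x,a)\in\mathscr P(\mathbb R)$. Let $\pi$ (target) and $\mu$ (behaviour) be Markov policies and let $\nu$ be a probability distribution on $\mathcal X\times\mathcal A$. A trajectory following $\mu$ is a process $(X_t,A_t,R_t)_{t\ge 0}$ with $X_{t+1}\sim P(\cdot\mid X_t,A_t)$, $A_{t+1}\sim\mu(\cdot\mid X_{t+1})$, $R_t\sim\mathcal R(X_t,A_t)$; write $\bar\rho_t=\min\bigl(1,\pi(A_t\mid X_t)/\mu(A_t\mid X_t)\bigr)$. For $\alpha\in[0,1]$ define $$C(\alpha\mid x,a)=1-(1-\gamma)\,\mathbb E_\mu\Bigl[\sum_{t=0}^\infty\gamma^t\prod_{s=1}^t\bigl((1-\alpha)+\alpha\bar\rho_s\bigr)\Bigm|(X_0,A_0)=(x,a)\Bigr],\qquad C_\nu(\alpha)=\mathbb E_{(X,A)\sim\nu}[C(\alpha\mid X,A)].$$ Let $(x^{(k)}_t,a^{(k)}_t,r^{(k)}_t)_{t\ge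 0}$, $k=0,1,2,\dots$, be an i.i.d. sequence of trajectories following $\mu$ with initial state-action distribution $\nu$, let $\bar\rho^{(k)}_t$ be the corresponding truncated weights, and put $$\hat C^{(k)}(\alpha)=1-(1-\gamma)\sum_{t=0}^\infty\gamma^t\prod_{s=1}^t\bigl((1-\alpha)+\alpha\bar\rho^{(k)}_s\bigr).$$ Let $\sigma(\phi)=1/(1+e^{-\phi})$. Let $\Gamma$ be a target contraction rate with $0<\Gamma<C_\nu(1)$, and let the step sizes $\varepsilon_k\ge 0$ satisfy the Robbins–Monro conditions $\sum_{k}\varepsilon_k=\infty$ and $\sum_k\varepsilon_k^2<\infty$. Then there is a unique $\phi^*\in\mathbb R$ with $C_\nu(\sigma(\phi^*))=\Gamma$, and for every initial value $\phi_0\in\mathbb R$ the iterates $$\phi_{k+1}=\phi_k-\varepsilon_k\bigl(\hat C^{(k)}(\sigma(\phi_k))-\Gamma\bigr),\qquad k\ge 0,$$ converge to $\phi^*$ in probability. -/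

import Mathlib

open MeasureTheory ProbabilityTheory Filter

noncomputable section

/-- A Markov decision process with state space `X` and action space `A` (finite, discrete spaces in
the theorem): a discount factor in `[0, 1)`, a transition kernel `P(· | x, a)`, and reward
distributions `R(x, a)` on `ℝ`. -/
structure MDP (X A : Type*) [MeasurableSpace X] [MeasurableSpace A] where
  discount : ℝ
  discount_nonneg : 0 ≤ discount
  discount_lt_one : discount < 1
  transition : Kernel (X × A) X
  transition_markov : IsMarkovKernel transition
  reward : Kernel (X × A) ℝ
  reward_markov : IsMarkovKernel reward

namespace MDP

variable {X A : Type*} [MeasurableSpace X] [MeasurableSpace A]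

instance (M : MDP X A) : IsMarkovKernel M.transition := M.transition_markov

instance (M : MDP X A) : IsMarkovKernel M.reward := M.reward_markov

/-- One step of the process when acting with the policy `μ`: from a triple `((x, a), r)`, draw
`x' ∼ P(· | x, a)`, then `a' ∼ μ(· | x')`, then `r' ∼ R(x', a')`. -/
def stepKernel (M : MDP X A) (μ : Kernel X A) : Kernel ((X × A) × ℝ) ((X × A) × ℝ) :=
  ((M.transition ⊗ₖ μ.prodMkLeft (X × A)) ⊗ₖ M.reward.prodMkLeft (X × A)).comap
    Prod.fst measurable_fst

instance (M : MDP X A) (μ : Kernel X A) [IsMarkovKernel μ] : IsMarkovKernel (M.stepKernel μ) := by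
  unfold stepKernel; infer_instance

/-- The law of the trajectory `((X_t, A_t), R_t)_{t ≥ 0}` with `(X_0, A_0) ∼ ν` that follows the
policy `μ`: the first triple has law `ν ⊗ R`, and given the history up to time `n` the triple at
time `n + 1` is drawn from `stepKernel` at the triple at time `n`. -/
def trajectoryLaw (M : MDP X A) (μ : Kernel X A) [IsMarkovKernel μ] (ν : Measure (X × A)) :
    Measure (ℕ → (X × A) × ℝ) :=
  Kernel.trajMeasure (X := fun _ => (X × A) × ℝ) (ν ⊗ₘ M.reward)
    (fun n => (M.stepKernel μ).comap (fun h => h ⟨n, Finset.mem_Iic.2 le_rfl⟩)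
      (measurable_pi_apply _))

/-- The truncated importance weight `ρ̄ = min (1, π(a | x) / μ(a | x))`. -/
def truncatedRatio (π μ : Kernel X A) (z : X × A) : ℝ :=
  min 1 ((π z.1).real {z.2} / (μ z.1).real {z.2})

/-- The single-trajectory estimate
`Ĉ(α) = 1 - (1 - γ) ∑_{t ≥ 0} γ ^ t ∏_{s = 1}^t ((1 - α) + α ρ̄_s)`. -/
def rateEstimate (M : MDP X A) (π μ : Kernel X A) (α : ℝ) (τ : ℕ → (X × A) × ℝ) : ℝ :=
  1 - (1 - M.discount) * ∑' t : ℕ, M.discount ^ t *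
    ∏ s ∈ Finset.Icc 1 t, ((1 - α) + α * truncatedRatio π μ (τ s).1)

/-- The contraction rate `C(α | x, a)` of the `α`-Retrace operator at the pair `z = (x, a)`: the
expectation of `rateEstimate` over trajectories following `μ` from `(X_0, A_0) = (x, a)`. -/
def contractionRate (M : MDP X A) (π μ : Kernel X A) [IsMarkovKernel μ] (α : ℝ) (z : X × A) : ℝ :=
  1 - (1 - M.discount) * ∫ τ, (∑' t : ℕ, M.discount ^ t *
    ∏ s ∈ Finset.Icc 1 t, ((1 - α) + α * truncatedRatio π μ (τ s).1))
      ∂(M.trajectoryLaw μ (Measure.dirac z))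

/-- The averaged contraction rate `C_ν(α) = E_{(X, A) ∼ ν} [C(α | X, A)]`. -/
def averagedRate (M : MDP X A) (π μ : Kernel X A) [IsMarkovKernel μ] (ν : Measure (X × A))
    (α : ℝ) : ℝ :=
  ∫ z, M.contractionRate π μ α z ∂ν

/-- The Robbins-Monro iterates
`φ_{k + 1} = φ_k - ε_k (Ĉ^{(k)}(σ(φ_k)) - Γ)` driven by the trajectories `τ 0, τ 1, …`. -/
def iterate (M : MDP X A) (π μ : Kernel X A) (Γ : ℝ) (ε : ℕ → ℝ) (φ₀ : ℝ)
    (τ : ℕ → ℕ → (X × A) × ℝ) : ℕ → ℝ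
  | 0 => φ₀
  | k + 1 => iterate M π μ Γ ε φ₀ τ k -
      ε k * (M.rateEstimate π μ (Real.sigmoid (iterate M π μ Γ ε φ₀ τ k)) (τ k) - Γ)

end MDP

end

/-! For each trajectory the estimate is `1` minus a positive combination of products of factors
affine in `α`, nonnegative and nonincreasing on `[0, 1]`. Such products are convex, so the estimate
is concave, nondecreasing and continuous, and it vanishes at `0`; integration passes this on to the
averaged rate. A concave nondecreasing function is strictly increasing until it reaches its value at
`1`, and the sigmoid is an increasing bijection onto `(0, 1)`, so the mean field `h(φ) = C_ν(σ(φ)) -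
Γ` is monotone with a strict sign change at a single `φ*`.

Convergence uses two Lyapunov functions in expectation. The square of `φ - φ*` yields `E[(φ_k - φ*)
h(φ_k)]` arbitrarily small at arbitrarily late times, because the step sizes have infinite sum. As
`h` is bounded, this quantity dominates only linear growth, so it is compared with `V(φ) = √(1 + (φ
- φ*)²) - 1`. One step raises `E V` by at most `ε_k²`, so once small at a late time it stays small
(`tendsto_zero_of_robbinsMonro_recursion`). Markov's inequality gives convergence in probability. -/

/-! ### Deterministic recursion. -/

/-- Deterministic core of the Robbins-Monro argument: if `a` is a nonnegative sequence driven down by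
`ε b`, and the almost decreasing sequence `v` is controlled by `b`, then `v` tends to zero. -/
lemma tendsto_zero_of_robbinsMonro_recursion {a b v ε : ℕ → ℝ}
    (ha : ∀ k, 0 ≤ a k) (hv : ∀ k, 0 ≤ v k) (hε : ∀ k, 0 ≤ ε k)
    (hε_sum : Tendsto (fun n => ∑ k ∈ Finset.range n, ε k) atTop atTop)
    (hε_sq : Summable (fun k => ε k ^ 2))
    (hab : ∀ k, a (k + 1) ≤ a k - 2 * (ε k * b k) + ε k ^ 2)
    (hvv : ∀ k, v (k + 1) ≤ v k + ε k ^ 2)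
    (hvb : ∀ δ > 0, ∃ C, 0 ≤ C ∧ ∀ k, v k ≤ δ + C * b k) :
    Tendsto v atTop (nhds 0) := by
  have hfreq : ∀ η > 0, ∀ K, ∃ k ≥ K, b k < η := by
    intro η hη K
    by_contra! hb
    -- The sum of `ε` over the first `K` indices is added to both sides, so that `hε_sum` applies
    -- without a shift.
    have hbound : ∀ n, a (K + n) + 2 * η * (∑ k ∈ Finset.range (K + n), ε k) ≤
        a K + 2 * η * (∑ k ∈ Finset.range K, ε k) + ∑ k ∈ Finset.range n, ε (K + k) ^ 2 := by
      intro n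
      induction n with
      | zero => simp
      | succ n ih =>
        rw [← add_assoc, Finset.sum_range_succ, Finset.sum_range_succ]
        have h1 := hab (K + n)
        have h2 := mul_le_mul_of_nonneg_left (hb (K + n) (by omega)) (hε (K + n))
        linarith
    have hs : ∀ n, ∑ k ∈ Finset.range n, ε (K + k) ^ 2 ≤ ∑' k, ε k ^ 2 := by
      intro n
      have h := hε_sq.sum_le_tsum (Finset.range (K + n)) (fun i _ => sq_nonneg _)
      rw [Finset.sum_range_add] at h
      have : 0 ≤ ∑ k ∈ Finset.range K, ε k ^ 2 := Finset.sum_nonneg fun i _ => sq_nonneg _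
      linarith
    set B := a K + 2 * η * (∑ k ∈ Finset.range K, ε k) + ∑' k, ε k ^ 2 with hB
    -- Past this threshold `2η ∑ ε` exceeds `B` by at least `2η`, which contradicts `0 ≤ a`.
    obtain ⟨n, hn⟩ := ((tendsto_atTop.1 hε_sum (B / (2 * η) + 1)).and
      (eventually_ge_atTop K)).exists
    obtain ⟨m, rfl⟩ := Nat.exists_eq_add_of_le hn.2
    have h1 := hbound m
    have h2 := hs m
    have h3 := ha (K + m)
    have h4 : 2 * η * (B / (2 * η) + 1) ≤ 2 * η * ∑ k ∈ Finset.range (K + m), ε k :=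
      mul_le_mul_of_nonneg_left hn.1 (by positivity)
    have h5 : 2 * η * (B / (2 * η) + 1) = B + 2 * η := by field_simp
    linarith
  have hgrow : ∀ k n, v (k + n) ≤ v k + ∑' j, ε (j + k) ^ 2 := by
    intro k n
    have h : v (k + n) ≤ v k + ∑ j ∈ Finset.range n, ε (j + k) ^ 2 := by
      induction n with
      | zero => simp
      | succ n ih =>
        rw [← add_assoc, Finset.sum_range_succ, add_comm n k]
        linarith [hvv (k + n)]
    refine h.trans (add_le_add_right ?_ _)
    exact ((summable_nat_add_iff (f := fun j => ε j ^ 2) k).2 hε_sq).sum_le_tsum _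
      (fun i _ => sq_nonneg _)
  rw [Metric.tendsto_atTop]
  intro η hη
  -- Error budget: `η / 4` each for `δ`, for `C * b k` and for the tail of `∑ ε²`. Dividing by `C +
  -- 1` below covers `C = 0`.
  obtain ⟨C, hC, hCb⟩ := hvb (η / 4) (by positivity)
  have htail := tendsto_sum_nat_add (fun j => ε j ^ 2)
  obtain ⟨K, hK⟩ := (Metric.tendsto_atTop.1 htail) (η / 4) (by positivity)
  obtain ⟨k, hkK, hk⟩ := hfreq (η / (4 * (C + 1))) (by positivity) K
  refine ⟨k, fun n hn => ?_⟩
  obtain ⟨m, rfl⟩ := Nat.exists_eq_add_of_le hn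
  rw [Real.dist_eq, sub_zero, abs_of_nonneg (hv _)]
  have h1 := hgrow k m
  have h2 := hK k hkK
  rw [Real.dist_eq, sub_zero] at h2
  have h3 := le_abs_self (∑' j, ε (j + k) ^ 2)
  have h4 := hCb k
  have h5 : C * b k ≤ C * (η / (4 * (C + 1))) := mul_le_mul_of_nonneg_left hk.le hC
  have h6 : C * (η / (4 * (C + 1))) ≤ η / 4 := by
    rw [mul_div_assoc', div_le_div_iff₀ (by positivity) (by positivity)]
    nlinarith
  linarith

/-! ### Robbins–Monro convergence for bounded noise. -/

/-- Stochastic approximation with the random fields `F · (ξ k)`, step sizes `ε` and start `φ₀`. -/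
def stochasticApproximation {S : Type*} (F : ℝ → S → ℝ) (ε : ℕ → ℝ) (φ₀ : ℝ) (ξ : ℕ → S) : ℕ → ℝ
  | 0 => φ₀
  | k + 1 => stochasticApproximation F ε φ₀ ξ k -
      ε k * F (stochasticApproximation F ε φ₀ ξ k) (ξ k)

section StochasticApproximation

variable {S Ω : Type*} [MeasurableSpace S] [MeasurableSpace Ω] {F : ℝ → S → ℝ} {ε : ℕ → ℝ}
  {φ₀ : ℝ} {ξ : ℕ → Ω → S}

-- Iterate `k` has consumed only the samples with index `< k`; the strict inequality is what makes
-- it independent of `ξ k`.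
omit [MeasurableSpace Ω] in
lemma measurable_stochasticApproximation_iSup (hF : Measurable (Function.uncurry F)) (k : ℕ) :
    Measurable[⨆ i ∈ Set.Iio k, MeasurableSpace.comap (ξ i) inferInstance]
      (fun ω => stochasticApproximation F ε φ₀ (fun j => ξ j ω) k) := by
  induction k with
  | zero => exact measurable_const
  | succ k ih =>
    have h1 : Measurable[⨆ i ∈ Set.Iio (k + 1), MeasurableSpace.comap (ξ i) inferInstance]
        (fun ω => stochasticApproximation F ε φ₀ (fun j => ξ j ω) k) :=
      ih.mono (biSup_mono fun i hi => lt_trans hi (Nat.lt_succ_self k)) le_rfl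
    have h2 : Measurable[⨆ i ∈ Set.Iio (k + 1), MeasurableSpace.comap (ξ i) inferInstance]
        (ξ k) :=
      (comap_measurable (ξ k)).mono
        (le_biSup (fun i => MeasurableSpace.comap (ξ i) inferInstance)
          (Set.mem_Iio.2 (Nat.lt_succ_self k))) le_rfl
    exact h1.sub ((hF.comp (h1.prodMk h2)).const_mul (ε k))

lemma measurable_stochasticApproximation (hF : Measurable (Function.uncurry F))
    (hξ : ∀ k, Measurable (ξ k)) (k : ℕ) :
    Measurable (fun ω => stochasticApproximation F ε φ₀ (fun j => ξ j ω) k) :=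
  (measurable_stochasticApproximation_iSup hF k).mono
    (iSup₂_le fun i _ => (hξ i).comap_le) le_rfl

lemma indepFun_stochasticApproximation {P : Measure Ω} (hF : Measurable (Function.uncurry F))
    (hξ : ∀ k, Measurable (ξ k)) (hindep : iIndepFun ξ P) (k : ℕ) :
    IndepFun (fun ω => stochasticApproximation F ε φ₀ (fun j => ξ j ω) k) (ξ k) P := by
  have h := indep_iSup_of_disjoint (fun i => (hξ i).comap_le) hindep
    (S := Set.Iio k) (T := {k}) (by simp)
  rw [IndepFun_iff_Indep]
  refine indep_of_indep_of_le_right (indep_of_indep_of_le_left h ?_) ?_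
  · exact (measurable_stochasticApproximation_iSup hF k).comap_le
  · simp

-- This deterministic bound confines each iterate to a compact interval, so every continuous
-- function of it is bounded and integrable.
omit [MeasurableSpace S] in
lemma abs_stochasticApproximation_sub_le (hF1 : ∀ φ s, |F φ s| ≤ 1) (hε : ∀ k, 0 ≤ ε k)
    (s : ℕ → S) (k : ℕ) :
    |stochasticApproximation F ε φ₀ s k - φ₀| ≤ ∑ j ∈ Finset.range k, ε j := by
  induction k with
  | zero => simp [stochasticApproximation]
  | succ k ih =>
    rw [Finset.sum_range_succ, stochasticApproximation]
    set x := stochasticApproximation F ε φ₀ s k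
    have h1 : |ε k * F x (s k)| ≤ ε k := by
      rw [abs_mul, abs_of_nonneg (hε k)]
      exact mul_le_of_le_one_right (hε k) (hF1 _ _)
    calc |x - ε k * F x (s k) - φ₀| = |(x - φ₀) - ε k * F x (s k)| := by congr 1; ring
      _ ≤ |x - φ₀| + |ε k * F x (s k)| := abs_sub _ _
      _ ≤ _ := add_le_add ih h1

/-- Independence makes the joint law of iterate and fresh sample a product, so Fubini replaces the
noise by its mean field without conditional expectations. -/
lemma integral_mul_stochasticApproximation {P : Measure Ω} [IsProbabilityMeasure P]
    {Q : Measure S} [IsProbabilityMeasure Q]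
    (hF : Measurable (Function.uncurry F)) (hF1 : ∀ φ s, |F φ s| ≤ 1)
    (hξ : ∀ k, Measurable (ξ k)) (hlaw : ∀ k, P.map (ξ k) = Q) (hindep : iIndepFun ξ P)
    (hε : ∀ k, 0 ≤ ε k) (k : ℕ) {g : ℝ → ℝ} (hg : Continuous g) :
    ∫ ω, g (stochasticApproximation F ε φ₀ (fun j => ξ j ω) k) *
        F (stochasticApproximation F ε φ₀ (fun j => ξ j ω) k) (ξ k ω) ∂P =
      ∫ ω, g (stochasticApproximation F ε φ₀ (fun j => ξ j ω) k) *
        ∫ s, F (stochasticApproximation F ε φ₀ (fun j => ξ j ω) k) s ∂Q ∂P := by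
  set Φ := fun ω => stochasticApproximation F ε φ₀ (fun j => ξ j ω) k with hΦ
  have hΦm : Measurable Φ := measurable_stochasticApproximation hF hξ k
  have hmap : P.map (fun ω => (Φ ω, ξ k ω)) = (P.map Φ).prod Q := by
    rw [← hlaw k]
    exact (indepFun_iff_map_prod_eq_prod_map_map hΦm.aemeasurable (hξ k).aemeasurable).1
      (indepFun_stochasticApproximation hF hξ hindep k)
  have hGm : Measurable (fun p : ℝ × S => g p.1 * F p.1 p.2) :=
    (hg.measurable.comp measurable_fst).mul hF
  obtain ⟨C, hC⟩ := (isCompact_Icc (a := φ₀ - ∑ j ∈ Finset.range k, ε j)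
    (b := φ₀ + ∑ j ∈ Finset.range k, ε j)).exists_bound_of_continuousOn hg.continuousOn
  have hgC : ∀ ω, ‖g (Φ ω)‖ ≤ C := fun ω => hC _ (by
    have := abs_le.1 (abs_stochasticApproximation_sub_le (φ₀ := φ₀) hF1 hε (fun j => ξ j ω) k)
    constructor <;> simp only [hΦ] <;> linarith)
  have hint : Integrable (fun p : ℝ × S => g p.1 * F p.1 p.2) ((P.map Φ).prod Q) := by
    rw [← hmap, integrable_map_measure hGm.aestronglyMeasurable
      (hΦm.prodMk (hξ k)).aemeasurable]
    refine Integrable.of_bound (hGm.comp (hΦm.prodMk (hξ k))).aestronglyMeasurable C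
      (ae_of_all _ fun ω => ?_)
    simp only [Function.comp, norm_mul]
    exact (mul_le_of_le_one_right (norm_nonneg _) (hF1 _ _)).trans (hgC ω)
  have h1 := integral_map (μ := P) (hΦm.prodMk (hξ k)).aemeasurable hGm.aestronglyMeasurable
  rw [hmap, integral_prod _ hint] at h1
  rw [← h1, integral_map hΦm.aemeasurable hint.integral_prod_left.aestronglyMeasurable]
  simp only [integral_const_mul, hΦ]

/-- Robbins-Monro: bounded noise fields whose mean field is monotone with a strict sign change at
`φstar` give iterates that converge to `φstar` in probability. -/
theorem tendstoInMeasure_stochasticApproximation {P : Measure Ω} [IsProbabilityMeasure P]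
    {Q : Measure S} [IsProbabilityMeasure Q]
    (hF : Measurable (Function.uncurry F)) (hF1 : ∀ φ s, |F φ s| ≤ 1)
    (hξ : ∀ k, Measurable (ξ k)) (hlaw : ∀ k, P.map (ξ k) = Q) (hindep : iIndepFun ξ P)
    (hε : ∀ k, 0 ≤ ε k)
    (hε_sum : Tendsto (fun n => ∑ k ∈ Finset.range n, ε k) atTop atTop)
    (hε_sq : Summable (fun k => ε k ^ 2)) {φstar : ℝ}
    (hmono : Monotone fun φ => ∫ s, F φ s ∂Q)
    (hneg : ∀ φ < φstar, ∫ s, F φ s ∂Q < 0) (hpos : ∀ φ > φstar, 0 < ∫ s, F φ s ∂Q) :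
    TendstoInMeasure P (fun k ω => stochasticApproximation F ε φ₀ (fun j => ξ j ω) k) atTop
      (fun _ => φstar) := by
  set h : ℝ → ℝ := fun φ => ∫ s, F φ s ∂Q with hh
  set Φ : ℕ → Ω → ℝ := fun k ω => stochasticApproximation F ε φ₀ (fun j => ξ j ω) k with hΦ
  have hΦm : ∀ k, Measurable (Φ k) := measurable_stochasticApproximation hF hξ
  have hsucc : ∀ k ω, Φ (k + 1) ω = Φ k ω - ε k * F (Φ k ω) (ξ k ω) := fun k ω => rfl
  have hhm : Measurable h := hmono.measurable
  have hh1 : ∀ φ, |h φ| ≤ 1 := fun φ => by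
    have := norm_integral_le_of_norm_le_const (μ := Q) (f := F φ) (C := 1)
      (ae_of_all _ fun s => hF1 φ s)
    simpa using this
  have hsign : ∀ φ, 0 ≤ (φ - φstar) * h φ := fun φ => by
    rcases lt_trichotomy φ φstar with hlt | rfl | hgt
    · exact (mul_pos_of_neg_of_neg (sub_neg.2 hlt) (hneg φ hlt)).le
    · simp
    · exact (mul_pos (sub_pos.2 hgt) (hpos φ hgt)).le
  have hFm : ∀ k, Measurable fun ω => F (Φ k ω) (ξ k ω) := fun k =>
    hF.comp ((hΦm k).prodMk (hξ k))
  have hgbd : ∀ k (g : ℝ → ℝ), Continuous g → ∃ C, ∀ ω, ‖g (Φ k ω)‖ ≤ C := fun k g hg => by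
    obtain ⟨C, hC⟩ := (isCompact_Icc (a := φ₀ - ∑ j ∈ Finset.range k, ε j)
      (b := φ₀ + ∑ j ∈ Finset.range k, ε j)).exists_bound_of_continuousOn hg.continuousOn
    refine ⟨C, fun ω => hC _ ?_⟩
    have := abs_le.1 (abs_stochasticApproximation_sub_le (φ₀ := φ₀) hF1 hε (fun j => ξ j ω) k)
    constructor <;> simp only [hΦ] <;> linarith
  have hgint : ∀ k (g : ℝ → ℝ), Continuous g → Integrable (fun ω => g (Φ k ω)) P :=
    fun k g hg => by
      obtain ⟨C, hC⟩ := hgbd k g hg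
      exact Integrable.of_bound (hg.measurable.comp (hΦm k)).aestronglyMeasurable C
        (ae_of_all _ hC)
  have hgFint : ∀ k (g : ℝ → ℝ), Continuous g →
      Integrable (fun ω => g (Φ k ω) * F (Φ k ω) (ξ k ω)) P := fun k g hg =>
    (hgint k g hg).mul_bdd (c := 1) (hFm k).aestronglyMeasurable (ae_of_all _ fun ω => hF1 _ _)
  have hghint : ∀ k (g : ℝ → ℝ), Continuous g →
      Integrable (fun ω => g (Φ k ω) * h (Φ k ω)) P := fun k g hg =>
    (hgint k g hg).mul_bdd (c := 1) (hhm.comp (hΦm k)).aestronglyMeasurable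
      (ae_of_all _ fun ω => hh1 _)
  have hfreeze : ∀ k (g : ℝ → ℝ), Continuous g →
      ∫ ω, g (Φ k ω) * F (Φ k ω) (ξ k ω) ∂P = ∫ ω, g (Φ k ω) * h (Φ k ω) ∂P := fun k g hg =>
    integral_mul_stochasticApproximation hF hF1 hξ hlaw hindep hε k hg
  have hFsq : ∀ φ s, F φ s ^ 2 ≤ 1 := fun φ s => (sq_le_one_iff_abs_le_one _).2 (hF1 φ s)
  -- `V` grows linearly, as the drift of the square does, yet is smooth at `φstar`, which makes the
  -- one-step error quadratic in `ε`. `W` below is its derivative.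
  let V : ℝ → ℝ := fun φ => √(1 + (φ - φstar) ^ 2) - 1
  have hV : Continuous V := by fun_prop
  have hV0 : ∀ φ, 0 ≤ V φ := fun φ => by
    have : 1 ≤ √(1 + (φ - φstar) ^ 2) := Real.one_le_sqrt.2 (by nlinarith [sq_nonneg (φ - φstar)])
    simp only [V]; linarith
  have hVabs : ∀ φ, V φ ≤ |φ - φstar| := fun φ => by
    have : √(1 + (φ - φstar) ^ 2) ≤ 1 + |φ - φstar| := by
      rw [Real.sqrt_le_left (by positivity)]
      nlinarith [sq_abs (φ - φstar), abs_nonneg (φ - φstar)]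
    simp only [V]; linarith
  let W : ℝ → ℝ := fun φ => (φ - φstar) / √(1 + (φ - φstar) ^ 2)
  have hW : Continuous W := by
    refine Continuous.div (by fun_prop) (by fun_prop) fun φ => ?_
    positivity
  have hV_step : ∀ φ u, V (φ - u) ≤ V φ - u * W φ + u ^ 2 := fun φ u => by
    have hs1 : 1 ≤ √(1 + (φ - φstar) ^ 2) :=
      Real.one_le_sqrt.2 (by nlinarith [sq_nonneg (φ - φstar)])
    have hs2 : √(1 + (φ - φstar) ^ 2) ^ 2 = 1 + (φ - φstar) ^ 2 := Real.sq_sqrt (by positivity)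
    simp only [V, W]
    set s := √(1 + (φ - φstar) ^ 2)
    have hWs : (φ - φstar) / s * s = φ - φstar := div_mul_cancel₀ _ (by positivity)
    set w := (φ - φstar) / s
    have hw1 : w ^ 2 ≤ 1 := by
      have : w ^ 2 * s ^ 2 = s ^ 2 - 1 := by rw [← mul_pow, hWs, hs2]; ring
      nlinarith
    have hwabs := abs_le.1 ((sq_le_one_iff_abs_le_one w).1 hw1)
    have hnn : 0 ≤ s - u * w + u ^ 2 := by nlinarith [sq_nonneg (u - w / 2)]
    -- Squaring leaves the surplus `(2s - 1) u² + (uw - u²)²`, nonnegative because `s ≥ 1`.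
    have : √(1 + (φ - u - φstar) ^ 2) ≤ s - u * w + u ^ 2 := by
      rw [Real.sqrt_le_left hnn]
      have e1 : 1 + (φ - u - φstar) ^ 2 = s ^ 2 - 2 * u * (w * s) + u ^ 2 := by
        rw [hWs, hs2]; ring
      have e2 : (s - u * w + u ^ 2) ^ 2 =
        s ^ 2 - 2 * u * (w * s) + 2 * s * u ^ 2 + (u * w - u ^ 2) ^ 2 := by ring
      rw [e1, e2]
      nlinarith [sq_nonneg (u * w - u ^ 2), mul_nonneg (sub_nonneg.2 hs1) (sq_nonneg u),
        sq_nonneg u]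
    linarith
  have hWh : ∀ φ, 0 ≤ W φ * h φ := fun φ => by
    have : W φ * h φ = (φ - φstar) * h φ / √(1 + (φ - φstar) ^ 2) := by simp only [W]; ring
    rw [this]
    exact div_nonneg (hsign φ) (Real.sqrt_nonneg _)
  have hvlim : Tendsto (fun k => ∫ ω, V (Φ k ω) ∂P) atTop (nhds 0) := by
    refine tendsto_zero_of_robbinsMonro_recursion
      (a := fun k => ∫ ω, (Φ k ω - φstar) ^ 2 ∂P)
      (b := fun k => ∫ ω, (Φ k ω - φstar) * h (Φ k ω) ∂P)
      (fun k => integral_nonneg fun ω => sq_nonneg _)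
      (fun k => integral_nonneg fun ω => hV0 _) hε hε_sum hε_sq ?_ ?_ ?_
    · intro k
      have i0 := hgint k (fun φ => (φ - φstar) ^ 2) (by fun_prop)
      have i1 := (hgFint k (fun φ => φ - φstar) (by fun_prop)).const_mul (2 * ε k)
      have i2 : Integrable (fun ω => (Φ k ω - φstar) ^ 2 -
          2 * ε k * ((Φ k ω - φstar) * F (Φ k ω) (ξ k ω))) P := i0.sub i1
      have hle : ∫ ω, (Φ (k + 1) ω - φstar) ^ 2 ∂P ≤ ∫ ω, ((Φ k ω - φstar) ^ 2 -
          2 * ε k * ((Φ k ω - φstar) * F (Φ k ω) (ξ k ω)) + ε k ^ 2) ∂P := by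
        refine integral_mono (hgint (k + 1) (fun φ => (φ - φstar) ^ 2) (by fun_prop))
          (i2.add (integrable_const _)) fun ω => ?_
        simp only [hsucc]
        nlinarith [mul_le_mul_of_nonneg_left (hFsq (Φ k ω) (ξ k ω)) (sq_nonneg (ε k))]
      rw [integral_add i2 (integrable_const _), integral_sub i0 i1, integral_const_mul,
        hfreeze k (fun φ => φ - φstar) (by fun_prop)] at hle
      simp at hle
      linarith
    · intro k
      have i0 := hgint k V hV
      have i1 := (hgFint k W hW).const_mul (ε k)
      have i2 : Integrable (fun ω => V (Φ k ω) - ε k * (W (Φ k ω) * F (Φ k ω) (ξ k ω))) P :=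
        i0.sub i1
      have hle : ∫ ω, V (Φ (k + 1) ω) ∂P ≤ ∫ ω, (V (Φ k ω) -
          ε k * (W (Φ k ω) * F (Φ k ω) (ξ k ω)) + ε k ^ 2) ∂P := by
        refine integral_mono (hgint (k + 1) V hV)
          (i2.add (integrable_const _)) fun ω => ?_
        have := hV_step (Φ k ω) (ε k * F (Φ k ω) (ξ k ω))
        simp only [hsucc]
        nlinarith [mul_le_mul_of_nonneg_left (hFsq (Φ k ω) (ξ k ω)) (sq_nonneg (ε k))]
      rw [integral_add i2 (integrable_const _), integral_sub i0 i1, integral_const_mul, hfreeze k W hW] at hle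
      have h0 : 0 ≤ ε k * ∫ ω, W (Φ k ω) * h (Φ k ω) ∂P :=
        mul_nonneg (hε k) (integral_nonneg fun ω => hWh _)
      simp at hle
      linarith
    · intro δ hδ
      have hp := hpos (φstar + δ) (by linarith)
      have hn := hneg (φstar - δ) (by linarith)
      -- By monotonicity `|h| ≥ c` outside the `δ`-ball, so there `|φ - φstar|` is at most `c⁻¹ (φ -
      -- φstar) h φ`.
      set c := min (h (φstar + δ)) (-h (φstar - δ)) with hc
      have hc0 : 0 < c := lt_min hp (neg_pos.2 hn)
      refine ⟨c⁻¹, by positivity, fun k => ?_⟩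
      have hpt : ∀ φ, V φ ≤ δ + c⁻¹ * ((φ - φstar) * h φ) := by
        intro φ
        refine (hVabs φ).trans ?_
        have h0 := mul_nonneg (inv_nonneg.2 hc0.le) (hsign φ)
        rcases le_or_gt |φ - φstar| δ with hle | hgt
        · linarith
        · have habs : c ≤ |h φ| := by
            rcases lt_abs.1 hgt with h1 | h1
            · exact ((min_le_left _ _).trans (hmono (by linarith : φstar + δ ≤ φ))).trans
                (le_abs_self _)
            · exact ((min_le_right _ _).trans
                (neg_le_neg (hmono (by linarith : φ ≤ φstar - δ)))).trans (neg_le_abs _)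
          have h1 : |φ - φstar| ≤ c⁻¹ * ((φ - φstar) * h φ) := by
            rw [← abs_of_nonneg (hsign φ), abs_mul, inv_mul_eq_div, le_div_iff₀ hc0]
            exact mul_le_mul_of_nonneg_left habs (abs_nonneg _)
          linarith
      have i1 := (hghint k (fun φ => φ - φstar) (by fun_prop)).const_mul c⁻¹
      have hle : ∫ ω, V (Φ k ω) ∂P ≤ ∫ ω, (δ + c⁻¹ * ((Φ k ω - φstar) * h (Φ k ω))) ∂P :=
        integral_mono (hgint k V hV) ((integrable_const δ).add i1) fun ω => hpt (Φ k ω)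
      rw [integral_add (integrable_const δ) i1, integral_const_mul] at hle
      simpa using hle
  rw [tendstoInMeasure_iff_measureReal_dist]
  intro δ hδ
  -- `r` is the value of `V` at distance `δ`, the level for Markov's inequality.
  set r := √(1 + δ ^ 2) - 1 with hr
  have hr0 : 0 < r := by
    rw [hr, sub_pos, Real.lt_sqrt (by norm_num)]
    nlinarith [pow_pos hδ 2]
  refine squeeze_zero (fun _ => measureReal_nonneg) (fun k => ?_)
    (by simpa using hvlim.const_mul r⁻¹)
  have hmarkov := mul_meas_ge_le_integral_of_nonneg (ae_of_all P fun ω => hV0 (Φ k ω))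
    (hgint k V hV) r
  rw [inv_mul_eq_div, le_div_iff₀ hr0, mul_comm]
  refine (mul_le_mul_of_nonneg_left (measureReal_mono fun ω hω => ?_) hr0.le).trans hmarkov
  simp only [Set.mem_ofPred_eq, Real.dist_eq] at hω ⊢
  refine sub_le_sub_right (Real.sqrt_le_sqrt (add_le_add_right ?_ 1)) 1
  rw [← sq_abs (Φ k ω - φstar)]
  exact pow_le_pow_left₀ hδ.le hω 2

end StochasticApproximation

/-! ### Monotonicity and concavity of the estimate along a trajectory. -/

/-- A product of convex functions is convex when both are nonnegative and vary in the same
direction, so the induction must carry all three properties together. -/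
lemma convexOn_antitoneOn_prod_of_affine {ι : Type*} {ρ : ι → ℝ} (hρ0 : ∀ s, 0 ≤ ρ s)
    (hρ1 : ∀ s, ρ s ≤ 1) (I : Finset ι) :
    ConvexOn ℝ (Set.Icc 0 1) (fun α : ℝ => ∏ s ∈ I, ((1 - α) + α * ρ s)) ∧
      AntitoneOn (fun α : ℝ => ∏ s ∈ I, ((1 - α) + α * ρ s)) (Set.Icc 0 1) ∧
      ∀ α ∈ Set.Icc (0 : ℝ) 1, 0 ≤ ∏ s ∈ I, ((1 - α) + α * ρ s) := by
  classical
  have hnn : ∀ s, ∀ α ∈ Set.Icc (0 : ℝ) 1, 0 ≤ (1 - α) + α * ρ s := fun s α hα =>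
    add_nonneg (sub_nonneg.2 hα.2) (mul_nonneg hα.1 (hρ0 s))
  have hanti : ∀ s, AntitoneOn (fun α : ℝ => (1 - α) + α * ρ s) (Set.Icc 0 1) :=
    fun s α _ β _ hαβ => by
      have := mul_nonneg (sub_nonneg.2 hαβ) (sub_nonneg.2 (hρ1 s))
      dsimp only
      linarith
  have hconv : ∀ s, ConvexOn ℝ (Set.Icc 0 1) (fun α : ℝ => (1 - α) + α * ρ s) := fun s =>
    ⟨convex_Icc 0 1, fun α _ β _ a b _ _ hab => by
      simp only [smul_eq_mul]
      have : a = 1 - b := by linarith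
      subst this
      apply le_of_eq
      ring⟩
  induction I using Finset.induction_on with
  | empty => exact ⟨by simpa using convexOn_const 1 (convex_Icc 0 1), by simp [AntitoneOn], by simp⟩
  | insert s I hs ih =>
    obtain ⟨h1, h2, h3⟩ := ih
    simp only [Finset.prod_insert hs]
    refine ⟨(hconv s).mul h1 (hnn s) h3 ?_, ?_, fun α hα => mul_nonneg (hnn s α hα) (h3 α hα)⟩
    · exact (hanti s).monovaryOn h2
    · exact fun α hα β hβ hαβ => mul_le_mul (hanti s hα hβ hαβ) (h2 hα hβ hαβ) (h3 β hβ)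
        (hnn s α hα)

namespace MDP

variable {X A : Type*} [MeasurableSpace X] [MeasurableSpace A]

lemma truncatedRatio_nonneg (π μ : Kernel X A) (z : X × A) : 0 ≤ truncatedRatio π μ z :=
  le_min zero_le_one (div_nonneg measureReal_nonneg measureReal_nonneg)

lemma truncatedRatio_le_one (π μ : Kernel X A) (z : X × A) : truncatedRatio π μ z ≤ 1 :=
  min_le_left _ _

lemma prod_truncatedRatio_mem_Icc (π μ : Kernel X A) (τ : ℕ → (X × A) × ℝ) (t : ℕ) {α : ℝ}
    (hα : α ∈ Set.Icc (0 : ℝ) 1) :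
    ∏ s ∈ Finset.Icc 1 t, ((1 - α) + α * truncatedRatio π μ (τ s).1) ∈ Set.Icc (0 : ℝ) 1 := by
  obtain ⟨-, h2, h3⟩ := convexOn_antitoneOn_prod_of_affine
    (ρ := fun s => truncatedRatio π μ (τ s).1) (fun s => truncatedRatio_nonneg π μ _)
    (fun s => truncatedRatio_le_one π μ _) (Finset.Icc 1 t)
  exact ⟨h3 α hα, by simpa using h2 (by simp) hα hα.1⟩

lemma norm_discounted_prod_le (M : MDP X A) (π μ : Kernel X A) (τ : ℕ → (X × A) × ℝ) (t : ℕ)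
    {α : ℝ} (hα : α ∈ Set.Icc (0 : ℝ) 1) :
    ‖M.discount ^ t * ∏ s ∈ Finset.Icc 1 t, ((1 - α) + α * truncatedRatio π μ (τ s).1)‖ ≤
      M.discount ^ t := by
  have h := prod_truncatedRatio_mem_Icc π μ τ t hα
  have hγ := pow_nonneg M.discount_nonneg t
  rw [Real.norm_of_nonneg (mul_nonneg hγ h.1)]
  exact mul_le_of_le_one_right hγ h.2

lemma summable_discounted_prod (M : MDP X A) (π μ : Kernel X A) (τ : ℕ → (X × A) × ℝ) {α : ℝ}
    (hα : α ∈ Set.Icc (0 : ℝ) 1) :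
    Summable fun t : ℕ => M.discount ^ t *
      ∏ s ∈ Finset.Icc 1 t, ((1 - α) + α * truncatedRatio π μ (τ s).1) :=
  Summable.of_norm_bounded (summable_geometric_of_lt_one M.discount_nonneg M.discount_lt_one)
    fun t => M.norm_discounted_prod_le π μ τ t hα

lemma rateEstimate_zero (M : MDP X A) (π μ : Kernel X A) (τ : ℕ → (X × A) × ℝ) :
    M.rateEstimate π μ 0 τ = 0 := by
  have : 1 - M.discount ≠ 0 := (sub_pos.2 M.discount_lt_one).ne'
  simp [rateEstimate, tsum_geometric_of_lt_one M.discount_nonneg M.discount_lt_one, this]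

lemma monotoneOn_rateEstimate (M : MDP X A) (π μ : Kernel X A) (τ : ℕ → (X × A) × ℝ) :
    MonotoneOn (fun α => M.rateEstimate π μ α τ) (Set.Icc 0 1) := by
  intro α hα β hβ hαβ
  refine sub_le_sub_left (mul_le_mul_of_nonneg_left ?_ (sub_nonneg.2 M.discount_lt_one.le)) 1
  refine (M.summable_discounted_prod π μ τ hβ).tsum_le_tsum (fun t => ?_)
    (M.summable_discounted_prod π μ τ hα)
  exact mul_le_mul_of_nonneg_left ((convexOn_antitoneOn_prod_of_affine
    (ρ := fun s => truncatedRatio π μ (τ s).1) (fun s => truncatedRatio_nonneg π μ _)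
    (fun s => truncatedRatio_le_one π μ _) (Finset.Icc 1 t)).2.1 hα hβ hαβ)
    (pow_nonneg M.discount_nonneg t)

lemma concaveOn_rateEstimate (M : MDP X A) (π μ : Kernel X A) (τ : ℕ → (X × A) × ℝ) :
    ConcaveOn ℝ (Set.Icc 0 1) (fun α => M.rateEstimate π μ α τ) := by
  refine ⟨convex_Icc 0 1, fun α hα β hβ a b ha hb hab => ?_⟩
  have hmem := convex_Icc (0 : ℝ) 1 hα hβ ha hb hab
  have sα := (M.summable_discounted_prod π μ τ hα).mul_left a
  have sβ := (M.summable_discounted_prod π μ τ hβ).mul_left b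
  have h := (M.summable_discounted_prod π μ τ hmem).tsum_le_tsum (fun t => by
    have := mul_le_mul_of_nonneg_left ((convexOn_antitoneOn_prod_of_affine
      (ρ := fun s => truncatedRatio π μ (τ s).1) (fun s => truncatedRatio_nonneg π μ _)
      (fun s => truncatedRatio_le_one π μ _) (Finset.Icc 1 t)).1.2 hα hβ ha hb hab)
      (pow_nonneg M.discount_nonneg t)
    simp only [smul_eq_mul] at this ⊢
    rw [mul_add, mul_left_comm _ a, mul_left_comm _ b] at this
    exact this) (sα.add sβ)
  rw [sα.tsum_add sβ, tsum_mul_left, tsum_mul_left] at h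
  have h' := mul_le_mul_of_nonneg_left h (sub_nonneg.2 M.discount_lt_one.le)
  simp only [rateEstimate, smul_eq_mul] at h' ⊢
  have : a = 1 - b := by linarith
  subst this
  linarith

lemma continuousOn_rateEstimate (M : MDP X A) (π μ : Kernel X A) (τ : ℕ → (X × A) × ℝ) :
    ContinuousOn (fun α => M.rateEstimate π μ α τ) (Set.Icc 0 1) := by
  refine continuousOn_const.sub (continuousOn_const.mul (continuousOn_tsum (fun t => ?_)
    (summable_geometric_of_lt_one M.discount_nonneg M.discount_lt_one)
    fun t α hα => M.norm_discounted_prod_le π μ τ t hα))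
  exact Continuous.continuousOn (by fun_prop)

lemma rateEstimate_mem_Icc (M : MDP X A) (π μ : Kernel X A) (τ : ℕ → (X × A) × ℝ) {α : ℝ}
    (hα : α ∈ Set.Icc (0 : ℝ) 1) : M.rateEstimate π μ α τ ∈ Set.Icc (0 : ℝ) 1 := by
  refine ⟨?_, sub_le_self 1 (mul_nonneg (sub_nonneg.2 M.discount_lt_one.le)
    (tsum_nonneg fun t => mul_nonneg (pow_nonneg M.discount_nonneg t)
      (prod_truncatedRatio_mem_Icc π μ τ t hα).1))⟩
  rw [← M.rateEstimate_zero π μ τ]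
  exact M.monotoneOn_rateEstimate π μ τ (by simp) hα hα.1

/-! ### Trajectory law and averaged rate. -/

variable [Finite X] [DiscreteMeasurableSpace X] [Finite A] [DiscreteMeasurableSpace A]

lemma measurable_uncurry_rateEstimate (M : MDP X A) (π μ : Kernel X A) :
    Measurable (Function.uncurry (M.rateEstimate π μ)) := by
  have hρ : Measurable (truncatedRatio π μ) := Measurable.of_discrete
  unfold Function.uncurry rateEstimate
  refine measurable_const.sub ((Measurable.tsum fun t => ?_).const_mul _)
  refine (Finset.measurable_fun_prod _ fun s _ => ?_).const_mul _
  have : Measurable fun p : ℝ × (ℕ → (X × A) × ℝ) => truncatedRatio π μ (p.2 s).1 :=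
    hρ.comp (measurable_fst.comp ((measurable_pi_apply s).comp measurable_snd))
  fun_prop

lemma measurable_rateEstimate (M : MDP X A) (π μ : Kernel X A) (α : ℝ) :
    Measurable (M.rateEstimate π μ α) :=
  (M.measurable_uncurry_rateEstimate π μ).of_uncurry_left

lemma integrable_rateEstimate (M : MDP X A) (π μ : Kernel X A) {α : ℝ}
    (hα : α ∈ Set.Icc (0 : ℝ) 1) (Q : Measure (ℕ → (X × A) × ℝ)) [IsFiniteMeasure Q] :
    Integrable (M.rateEstimate π μ α) Q :=
  Integrable.of_bound (M.measurable_rateEstimate π μ α).aestronglyMeasurable 1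
    (ae_of_all _ fun τ => by
      have h := M.rateEstimate_mem_Icc π μ τ hα
      rw [Real.norm_of_nonneg h.1]
      exact h.2)

omit [Finite X] [DiscreteMeasurableSpace X] [Finite A] [DiscreteMeasurableSpace A] in
/-- The trajectory law depends on the initial law through a Markov kernel. -/
lemma exists_trajectoryLaw_eq_comp (M : MDP X A) (μ : Kernel X A) [IsMarkovKernel μ] :
    ∃ η : Kernel (X × A) (ℕ → (X × A) × ℝ), IsMarkovKernel η ∧
      ∀ ν : Measure (X × A), [SFinite ν] → M.trajectoryLaw μ ν = η ∘ₘ ν := by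
  refine ⟨Kernel.traj (X := fun _ => (X × A) × ℝ)
      (fun n => (M.stepKernel μ).comap (fun h => h ⟨n, Finset.mem_Iic.2 le_rfl⟩)
        (measurable_pi_apply _)) 0 ∘ₖ
      (Kernel.deterministic (MeasurableEquiv.piUnique
        (fun _ : Finset.Iic 0 => (X × A) × ℝ)).symm (MeasurableEquiv.measurable _) ∘ₖ
          (Kernel.id ×ₖ M.reward)), inferInstance, fun ν _ => ?_⟩
  rw [trajectoryLaw, Kernel.trajMeasure, ← Measure.comp_assoc, ← Measure.comp_assoc,
    Measure.deterministic_comp_eq_map, Measure.compProd_eq_comp_prod]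

instance isProbabilityMeasure_trajectoryLaw (M : MDP X A) (μ : Kernel X A) [IsMarkovKernel μ]
    (ν : Measure (X × A)) [IsProbabilityMeasure ν] :
    IsProbabilityMeasure (M.trajectoryLaw μ ν) := by
  unfold trajectoryLaw; infer_instance

lemma contractionRate_eq_integral (M : MDP X A) (π μ : Kernel X A) [IsMarkovKernel μ] {α : ℝ}
    (hα : α ∈ Set.Icc (0 : ℝ) 1) (z : X × A) :
    M.contractionRate π μ α z =
      ∫ τ, M.rateEstimate π μ α τ ∂(M.trajectoryLaw μ (Measure.dirac z)) := by
  have hγ : 1 - M.discount ≠ 0 := (sub_pos.2 M.discount_lt_one).ne'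
  have hint : Integrable (fun τ => (1 - M.discount) * ∑' t : ℕ, M.discount ^ t *
      ∏ s ∈ Finset.Icc 1 t, ((1 - α) + α * truncatedRatio π μ (τ s).1))
      (M.trajectoryLaw μ (Measure.dirac z)) := by
    refine ((integrable_const (1 : ℝ)).sub
      (M.integrable_rateEstimate π μ hα _)).congr (ae_of_all _ fun τ => ?_)
    simp [rateEstimate]
  simp only [rateEstimate]
  rw [integral_sub (integrable_const 1) hint, integral_const_mul]
  simp [contractionRate]

/-- Tower rule: the law started from `ν` is the `ν`-mixture of the laws started from points.
Pathwise properties of the estimate then pass to the average under a single integral. -/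
lemma averagedRate_eq_integral (M : MDP X A) (π μ : Kernel X A) [IsMarkovKernel μ]
    (ν : Measure (X × A)) [IsProbabilityMeasure ν] {α : ℝ} (hα : α ∈ Set.Icc (0 : ℝ) 1) :
    M.averagedRate π μ ν α = ∫ τ, M.rateEstimate π μ α τ ∂(M.trajectoryLaw μ ν) := by
  obtain ⟨η, hη, h⟩ := M.exists_trajectoryLaw_eq_comp μ
  simp only [averagedRate, M.contractionRate_eq_integral π μ hα, h,
    Measure.dirac_bind η.measurable]
  rw [← Measure.snd_compProd, Measure.snd, integral_map measurable_snd.aemeasurable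
    (M.measurable_rateEstimate π μ α).aestronglyMeasurable, Measure.integral_compProd]
  exact (M.integrable_rateEstimate π μ hα ((ν ⊗ₘ η).map Prod.snd)).comp_measurable measurable_snd

lemma averagedRate_zero (M : MDP X A) (π μ : Kernel X A) [IsMarkovKernel μ]
    (ν : Measure (X × A)) [IsProbabilityMeasure ν] : M.averagedRate π μ ν 0 = 0 := by
  rw [M.averagedRate_eq_integral π μ ν (by simp)]
  simp [rateEstimate_zero]

lemma monotoneOn_averagedRate (M : MDP X A) (π μ : Kernel X A) [IsMarkovKernel μ]
    (ν : Measure (X × A)) [IsProbabilityMeasure ν] :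
    MonotoneOn (M.averagedRate π μ ν) (Set.Icc 0 1) := fun α hα β hβ hαβ => by
  rw [M.averagedRate_eq_integral π μ ν hα, M.averagedRate_eq_integral π μ ν hβ]
  exact integral_mono (M.integrable_rateEstimate π μ hα _) (M.integrable_rateEstimate π μ hβ _)
    fun τ => M.monotoneOn_rateEstimate π μ τ hα hβ hαβ

lemma concaveOn_averagedRate (M : MDP X A) (π μ : Kernel X A) [IsMarkovKernel μ]
    (ν : Measure (X × A)) [IsProbabilityMeasure ν] :
    ConcaveOn ℝ (Set.Icc 0 1) (M.averagedRate π μ ν) := by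
  refine ⟨convex_Icc 0 1, fun α hα β hβ a b ha hb hab => ?_⟩
  have hmem := convex_Icc (0 : ℝ) 1 hα hβ ha hb hab
  have iα := (M.integrable_rateEstimate π μ hα (M.trajectoryLaw μ ν)).const_mul a
  have iβ := (M.integrable_rateEstimate π μ hβ (M.trajectoryLaw μ ν)).const_mul b
  rw [M.averagedRate_eq_integral π μ ν hα, M.averagedRate_eq_integral π μ ν hβ,
    M.averagedRate_eq_integral π μ ν hmem, smul_eq_mul, smul_eq_mul, ← integral_const_mul,
    ← integral_const_mul, ← integral_add iα iβ]
  exact integral_mono (iα.add iβ) (M.integrable_rateEstimate π μ hmem _)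
    fun τ => (M.concaveOn_rateEstimate π μ τ).2 hα hβ ha hb hab

lemma continuousOn_averagedRate (M : MDP X A) (π μ : Kernel X A) [IsMarkovKernel μ]
    (ν : Measure (X × A)) [IsProbabilityMeasure ν] :
    ContinuousOn (M.averagedRate π μ ν) (Set.Icc 0 1) := by
  refine ContinuousOn.congr ?_ fun α hα => M.averagedRate_eq_integral π μ ν hα
  refine continuousOn_of_dominated (bound := fun _ => 1)
    (fun α _ => (M.measurable_rateEstimate π μ α).aestronglyMeasurable)
    (fun α hα => ae_of_all _ fun τ => ?_) (integrable_const 1)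
    (ae_of_all _ fun τ => M.continuousOn_rateEstimate π μ τ)
  have h := M.rateEstimate_mem_Icc π μ τ hα
  rw [Real.norm_of_nonneg h.1]
  exact h.2

/-- Below its value at `1`, the averaged rate is strictly increasing: it is concave and
nondecreasing. -/
lemma averagedRate_lt_averagedRate (M : MDP X A) (π μ : Kernel X A) [IsMarkovKernel μ]
    (ν : Measure (X × A)) [IsProbabilityMeasure ν] {α β : ℝ} (hα : α ∈ Set.Icc (0 : ℝ) 1)
    (hβ : β ∈ Set.Icc (0 : ℝ) 1) (hαβ : α < β)
    (h1 : M.averagedRate π μ ν α < M.averagedRate π μ ν 1) :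
    M.averagedRate π μ ν α < M.averagedRate π μ ν β := by
  have hα1 : 0 < 1 - α := by linarith [hβ.2]
  -- `β` is written as a convex combination of `α` and `1`; the positive weight on `1` makes the
  -- inequality strict.
  have hsum : (1 - β) / (1 - α) + (β - α) / (1 - α) = 1 := by field_simp; ring
  have hc := (M.concaveOn_averagedRate π μ ν).2 hα (Set.right_mem_Icc.2 zero_le_one)
    (div_nonneg (sub_nonneg.2 hβ.2) hα1.le) (div_nonneg (sub_nonneg.2 hαβ.le) hα1.le) hsum
  have hb : 0 < (β - α) / (1 - α) := div_pos (sub_pos.2 hαβ) hα1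
  have he : (1 - β) / (1 - α) = 1 - (β - α) / (1 - α) := by field_simp; ring
  have hβ' : (1 - β) / (1 - α) * α + (β - α) / (1 - α) * 1 = β := by field_simp; ring
  simp only [smul_eq_mul] at hc
  rw [hβ', he] at hc
  nlinarith [mul_pos hb (sub_pos.2 h1)]

omit [Finite X] [DiscreteMeasurableSpace X] [Finite A] [DiscreteMeasurableSpace A] in
lemma iterate_eq_stochasticApproximation (M : MDP X A) (π μ : Kernel X A) (Γ : ℝ) (ε : ℕ → ℝ)
    (φ₀ : ℝ) (τ : ℕ → ℕ → (X × A) × ℝ) (k : ℕ) :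
    M.iterate π μ Γ ε φ₀ τ k =
      stochasticApproximation (fun φ s => M.rateEstimate π μ (Real.sigmoid φ) s - Γ) ε φ₀ τ k := by
  induction k with
  | zero => rfl
  | succ k ih => rw [iterate, stochasticApproximation, ih]

end MDP

/-! ### The root and convergence to it. -/

theorem proposition3p4 {X A : Type*}
    [Finite X] [MeasurableSpace X] [DiscreteMeasurableSpace X]
    [Finite A] [MeasurableSpace A] [DiscreteMeasurableSpace A]
    (M : MDP X A) (π μ : Kernel X A) [IsMarkovKernel π] [IsMarkovKernel μ]
    (ν : Measure (X × A)) [IsProbabilityMeasure ν]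
    {Ω : Type*} [MeasurableSpace Ω] (P : Measure Ω) [IsProbabilityMeasure P]
    (τ : ℕ → Ω → ℕ → (X × A) × ℝ)
    (hτ_meas : ∀ k, Measurable (τ k))
    (hτ_law : ∀ k, P.map (τ k) = M.trajectoryLaw μ ν)
    (hτ_indep : iIndepFun τ P)
    (Γ : ℝ) (hΓ_pos : 0 < Γ) (hΓ_lt : Γ < M.averagedRate π μ ν 1)
    (ε : ℕ → ℝ) (hε_nonneg : ∀ k, 0 ≤ ε k)
    (hε_sum : Tendsto (fun n => ∑ k ∈ Finset.range n, ε k) atTop atTop)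
    (hε_sq : Summable (fun k => ε k ^ 2)) :
    ∃ φstar : ℝ,
      M.averagedRate π μ ν (Real.sigmoid φstar) = Γ ∧
      (∀ φ : ℝ, M.averagedRate π μ ν (Real.sigmoid φ) = Γ → φ = φstar) ∧
      ∀ φ₀ : ℝ, TendstoInMeasure P
        (fun k ω => M.iterate π μ Γ ε φ₀ (fun j => τ j ω) k) atTop (fun _ => φstar) := by
  have hσ : ∀ φ, Real.sigmoid φ ∈ Set.Icc (0 : ℝ) 1 := fun φ =>
    ⟨Real.sigmoid_nonneg φ, Real.sigmoid_le_one φ⟩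
  -- The open-interval version is needed: the sigmoid misses `0` and `1`.
  obtain ⟨α, hα, hαΓ⟩ := intermediate_value_Ioo zero_le_one (M.continuousOn_averagedRate π μ ν)
    ⟨by rwa [M.averagedRate_zero π μ ν], hΓ_lt⟩
  obtain ⟨φstar, rfl⟩ : α ∈ Set.range Real.sigmoid := by rwa [Real.range_sigmoid]
  have hmono : Monotone fun φ => M.averagedRate π μ ν (Real.sigmoid φ) := fun φ ψ h =>
    M.monotoneOn_averagedRate π μ ν (hσ φ) (hσ ψ) (Real.sigmoid_le h)
  have hgt : ∀ φ > φstar, Γ < M.averagedRate π μ ν (Real.sigmoid φ) := fun φ h => by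
    rw [← hαΓ] at hΓ_lt ⊢
    exact M.averagedRate_lt_averagedRate π μ ν (hσ _) (hσ φ) (Real.sigmoid_lt h) hΓ_lt
  have hlt : ∀ φ < φstar, M.averagedRate π μ ν (Real.sigmoid φ) < Γ := fun φ h => by
    have hle : M.averagedRate π μ ν (Real.sigmoid φ) ≤ M.averagedRate π μ ν (Real.sigmoid φstar) :=
      hmono h.le
    rw [← hαΓ]
    exact M.averagedRate_lt_averagedRate π μ ν (hσ φ) (hσ _) (Real.sigmoid_lt h)
      (hle.trans_lt (by rwa [hαΓ]))
  refine ⟨φstar, hαΓ, fun φ hφ => ?_, fun φ₀ => ?_⟩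
  · rcases lt_trichotomy φ φstar with h | h | h
    · exact absurd hφ (hlt φ h).ne
    · exact h
    · exact absurd hφ (hgt φ h).ne'
  · have hmean : ∀ φ, ∫ s, (M.rateEstimate π μ (Real.sigmoid φ) s - Γ) ∂(M.trajectoryLaw μ ν) =
        M.averagedRate π μ ν (Real.sigmoid φ) - Γ := fun φ => by
      rw [integral_sub (M.integrable_rateEstimate π μ (hσ φ) _) (integrable_const _),
        M.averagedRate_eq_integral π μ ν (hσ φ)]
      simp
    -- With `0 < Γ`, this bounds the noise field `Ĉ - Γ` by `1` in absolute value.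
    have hΓ1 : Γ ≤ 1 := by
      refine hΓ_lt.le.trans ?_
      rw [M.averagedRate_eq_integral π μ ν (by simp)]
      have := integral_mono (M.integrable_rateEstimate π μ (α := 1) (by simp)
        (M.trajectoryLaw μ ν)) (integrable_const 1)
        fun s => (M.rateEstimate_mem_Icc π μ s (by simp)).2
      simpa using this
    simp only [MDP.iterate_eq_stochasticApproximation]
    refine tendstoInMeasure_stochasticApproximation (Q := M.trajectoryLaw μ ν) ?_ ?_ hτ_meas
      hτ_law hτ_indep hε_nonneg hε_sum hε_sq ?_ ?_ ?_
    · exact ((M.measurable_uncurry_rateEstimate π μ).comp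
        ((continuous_sigmoid.measurable.comp measurable_fst).prodMk measurable_snd)).sub_const Γ
    · intro φ s
      have h := M.rateEstimate_mem_Icc π μ s (hσ φ)
      exact abs_le.2 ⟨by linarith [h.1], by linarith [h.2]⟩
    · simp only [hmean]
      exact fun φ ψ h => sub_le_sub_right (hmono h) Γ
    · intro φ h
      rw [hmean]
      exact sub_neg.2 (hlt φ h)
    · intro φ h
      rw [hmean]
      exact sub_pos.2 (hgt φ h)
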